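/- Let $G=(V,E)$ be a finite simple graph with $n=|V|$ vertices, one qubit sitting at each vertex. Let $U=U^{(1)}\cdots U^{(L)}$ be a quantum circuit of depth $L$ on $G$: each layer $U^{(\ell)}$ is a tensor product of unitary gates with pairwise disjoint supports (and of the identity on the idle qubits), each gate acting on a single qubit or on the two endpoints of an edge of $G$. Put $|\psi\rangle=U|0\rangle^{\otimes n}$. For $i\in V$ let $Z_i$ and $a_i$ be the operators that act on qubit $i$ as $Z=|0\rangle\langle 0|-|1\rangle\langle 1|$ and $|0\rangle\langle 1|$, respectively, and as the identity on the other qubits. For $\epsilon>0$ set $$\beta_\epsilon=\log(1/\epsilon),\qquad H_U=-\sum_{i\in V}UZ_iU^\dagger,\qquad \sigma(U)=\frac{e^{-\beta_\epsilon H_U}}{\operatorname{tr} e^{-\beta_\epsilon H_U}} .$$ For states $\rho,\sigma$ let $D(\rho\|\sigma)=\operatorname{tr}\rho(\log\rho-\log\sigma)$ (natural logarithm, $0\log 0=0$) be the relative entropy if the support of $\rho$ is contained in that of $\sigma$, and $D(\rho\|\sigma)=+\infty$ otherwise. Then for every $n$-qubit state (density matrix) $\rho$ and every observable (self-adjoint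 operator) $O$, $D(\rho\|\sigma(U))<\infty$ and $$\bigl|\operatorname{tr} O(|\psi\rangle\langle\psi|-\rho)\bigr|\le \|O\|_{\mathrm{Lip},\nabla}\Bigl(\sqrt{\epsilon n}+\sqrt{D(\rho\|\sigma(U))}\Bigr),$$ where $$\|O\|_{\mathrm{Lip},\nabla}^2=\sum_{i\in V}\Bigl(\bigl\|[O,Ua_iU^\dagger]\bigr\|^2+\bigl\|[O,Ua_i^\dagger U^\dagger]\bigr\|^2\Bigr)$$ and $\|\cdot\|$ is the operator norm. -/

import Mathlib

noncomputable section

open scoped ComplexOrder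

namespace QubitCircuit

variable {V : Type*} [Fintype V] [DecidableEq V]

/-- The computational basis of the qubits sitting at the points of `V`: bit strings. -/
abbrev Bits (V : Type*) : Type _ := V → Fin 2

/-- Operators on `(ℂ²)^{⊗ V}`, as matrices in the computational basis. -/
abbrev Op (V : Type*) : Type _ := Matrix (Bits V) (Bits V) ℂ

/-- The operator `A ⊗ I` with `A` acting on the qubits in `s` and the identity elsewhere. -/
def extend (s : Finset V) (A : Matrix (s → Fin 2) (s → Fin 2) ℂ) : Op V :=
  Matrix.of fun x y =>
    if ∀ j, j ∉ s → x j = y j then A (fun j => x j) (fun j => y j) else 0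

/-- The one-qubit operator `A` acting on qubit `i`, and the identity elsewhere. -/
def onSite (i : V) (A : Matrix (Fin 2) (Fin 2) ℂ) : Op V :=
  Matrix.of fun x y => if ∀ j, j ≠ i → x j = y j then A (x i) (y i) else 0

/-- Pauli `Z` on qubit `i`. -/
def pauliZ (i : V) : Op V := onSite i !![1, 0; 0, -1]

/-- The annihilation operator `|0⟩⟨1|` on qubit `i`. -/
def annihilation (i : V) : Op V := onSite i !![0, 1; 0, 0]

/-- A gate laid out according to the graph `G`: a unitary acting on a single qubit or on the two
endpoints of an edge of `G`. -/
structure Gate (G : SimpleGraph V) where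
  support : Finset V
  isLocal : (∃ v, support = {v}) ∨ ∃ v w, G.Adj v w ∧ support = {v, w}
  unitary : Matrix.unitaryGroup (support → Fin 2) ℂ

/-- A layer: gates on pairwise disjoint supports, applied in parallel. -/
structure Layer (G : SimpleGraph V) where
  gates : List (Gate G)
  disjoint : gates.Pairwise fun g h => Disjoint g.support h.support

/-- The tensor product of the gates of a layer (and of the identity on the idle qubits). The
supports being disjoint, it is the product, in any order, of the extended gates. -/
def Layer.op {G : SimpleGraph V} (l : Layer G) : Op V :=
  (l.gates.map fun g => extend g.support g.unitary.1).prod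

/-- A circuit of depth `L` on the interaction graph `G`: a sequence of `L` layers. -/
abbrev Circuit (G : SimpleGraph V) (L : ℕ) : Type _ := Fin L → Layer G

/-- The operator implemented by a circuit: the product of its layers. -/
def Circuit.op {G : SimpleGraph V} {L : ℕ} (C : Circuit G L) : Op V :=
  (List.ofFn fun l => (C l).op).prod

/-- The basis vector `|0⟩^{⊗ V}`. -/
def ketZero (V : Type*) [DecidableEq (Bits V)] : Bits V → ℂ := Pi.single 0 1

/-- The rank-one operator `|ψ⟩⟨ψ|`. -/
def ketbra (ψ : Bits V → ℂ) : Op V := Matrix.vecMulVec ψ (star ψ)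

/-- `U A U†`. -/
def conj (U A : Op V) : Op V := U * A * U.conjTranspose

/-- Density matrices. -/
def IsState (ρ : Op V) : Prop := ρ.PosSemidef ∧ ρ.trace = 1

/-- The Hamiltonian `H_U = - ∑ i, U Z_i U†`. -/
def hamiltonian (U : Op V) : Op V := -∑ i, conj U (pauliZ i)

/-- The Gibbs state `e^{-β H} / tr e^{-β H}`. -/
def gibbs (β : ℝ) (H : Op V) : Op V :=
  (NormedSpace.exp (-(β : ℂ) • H)).trace⁻¹ • NormedSpace.exp (-(β : ℂ) • H)

open Classical in
/-- Umegaki's relative entropy `D(ρ‖σ) = tr ρ (log ρ - log σ)` (natural logarithm, by functional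
calculus, with `0 log 0 = 0`) if the support of `ρ` is contained in that of `σ`, that is, if
`ker σ ⊆ ker ρ`, and `+∞` otherwise. -/
def relEntropy (ρ σ : Op V) : EReal :=
  if ∀ v : Bits V → ℂ, σ.mulVec v = 0 → ρ.mulVec v = 0 then
    (((ρ * (cfc Real.log ρ - cfc Real.log σ)).trace.re : ℝ) : EReal)
  else ⊤

/-- The operator norm with respect to the Hilbert space norm of `(ℂ²)^{⊗ V}`. -/
def opNorm (A : Op V) : ℝ := ‖Matrix.toEuclideanCLM (n := Bits V) (𝕜 := ℂ) A‖

/-- The commutator `[A, B]`. -/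
def comm (A B : Op V) : Op V := A * B - B * A

/-- The differential Lipschitz constant for the operators `U a_i U†` and `U a_i† U†`. -/
def lipschitz (U O : Op V) : ℝ :=
  √(∑ i : V, (opNorm (comm O (conj U (annihilation i))) ^ 2 +
    opNorm (comm O (conj U (annihilation i).conjTranspose)) ^ 2))

/-- The output vector `|ψ⟩ = U |0⟩^{⊗ V}` of a circuit. -/
def Circuit.output {G : SimpleGraph V} {L : ℕ} (C : Circuit G L) : Bits V → ℂ :=
  C.op.mulVec (ketZero V)

/-- The state `σ(U) = e^{-β_ε H_U} / tr e^{-β_ε H_U}` with `β_ε = log (1 / ε)`. -/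
def sigma (U : Op V) (ε : ℝ) : Op V := gibbs (Real.log ε⁻¹) (hamiltonian U)

end QubitCircuit

end

/-! Conjugating by `U` turns the output state into `|0…0⟩`, the state into `r = U†ρU` and `O` into
`U†OU`. Let `p_i` be the probability that qubit `i` of `r` is in `|1⟩`.

Transport: resetting the qubits to `|0⟩` one at a time carries `r` to `|0…0⟩`. A reset of qubit `i`
leaves the other occupations alone and moves the expectation of the conjugated observable by at most
`2‖[U†OU, a_i]‖√p_i` (`norm_trace_sub_reset_le`). Cauchy–Schwarz over the sites then gives the bound
`lipschitz U O * √(∑ 2 p_i)` (`norm_trace_output_sub_le`).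

Entropy: in the rotated basis `σ(U)` is a product state, each qubit being `1` with probability `q =
ε²/(1+ε²)`. Klein's inequality, with the product state of occupations `max p_i q` as trial state,
bounds `D(ρ‖σ(U))` below by a sum of one-qubit terms, each at least `2(√p_i - √q)₊²`
(`binary_relEntropy_ge`, `sum_hellinger_le_relEntropy`).

Since `2q ≤ ε`, one has `√(2p_i) ≤ √ε + √2 (√p_i - √q)₊`, and Minkowski's inequality in `ℓ²` joins
the two halves. -/

open scoped ComplexOrder

namespace QubitCircuit

/-! ### Functional calculus in a fixed orthonormal basis, and Klein's inequality -/

section Spectral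

variable {n : Type*} [Fintype n] [DecidableEq n]

/-- The diagonal operators in the orthonormal basis given by the columns of a unitary matrix. -/
noncomputable def diagonalIn (U : Matrix.unitaryGroup n ℂ) : (n → ℝ) →ₐ[ℝ] Matrix n n ℂ :=
  AlgHom.ofLinearMap
    { toFun := fun d => U.1 * Matrix.diagonal (fun x => (d x : ℂ)) * U.1.conjTranspose
      map_add' := fun d e => by
        simp only [Pi.add_apply, Complex.ofReal_add, ← Matrix.diagonal_add, mul_add, add_mul]
      map_smul' := fun c d => by
        have : (Matrix.diagonal fun x => (((c • d) x : ℝ) : ℂ)) =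
            c • Matrix.diagonal fun x => (d x : ℂ) := by
          ext i j
          by_cases h : i = j <;> simp [h]
        rw [this, Matrix.mul_smul, Matrix.smul_mul, RingHom.id_apply] }
    (by
      have : U.1 * U.1.conjTranspose = 1 := U.2.2
      simpa using this)
    (fun d e => by
      have h : U.1.conjTranspose * U.1 = 1 := U.2.1
      have h' : (Matrix.diagonal fun x => (((d * e) x : ℝ) : ℂ)) =
          (Matrix.diagonal fun x => (d x : ℂ)) * Matrix.diagonal fun x => (e x : ℂ) := by
        simp [Matrix.diagonal_mul_diagonal]
      simp only [LinearMap.coe_mk, AddHom.coe_mk, h', mul_assoc]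
      rw [← mul_assoc U.1.conjTranspose U.1, h, one_mul])

theorem diagonalIn_apply (U : Matrix.unitaryGroup n ℂ) (d : n → ℝ) :
    diagonalIn U d = U.1 * Matrix.diagonal (fun x => (d x : ℂ)) * U.1.conjTranspose := rfl

theorem isHermitian_diagonalIn (U : Matrix.unitaryGroup n ℂ) (d : n → ℝ) :
    (diagonalIn U d).IsHermitian := by
  rw [diagonalIn_apply]
  refine Matrix.isHermitian_mul_mul_conjTranspose _ ?_
  exact Matrix.isHermitian_diagonal_of_self_adjoint _ (by ext x; simp)

/-- The spectrum lies in the finite range of `d`, so `f` may be replaced by its interpolation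
polynomial there, and polynomials commute with algebra homomorphisms. -/
theorem cfc_diagonalIn (U : Matrix.unitaryGroup n ℂ) (d : n → ℝ) (f : ℝ → ℝ) :
    cfc f (diagonalIn U d) = diagonalIn U (f ∘ d) := by
  set q := Lagrange.interpolate (Finset.univ.image d) id f with hq
  have hqd (x : n) : q.eval (d x) = f (d x) :=
    Lagrange.eval_interpolate_at_node (v := id) f Function.injective_id.injOn
      (Finset.mem_image_of_mem d (Finset.mem_univ x))
  have hspec : spectrum ℝ (diagonalIn U d) ⊆ Set.range d := by
    refine (AlgHom.spectrum_apply_subset (diagonalIn U) d).trans ?_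
    rw [Pi.spectrum_eq]
    intro y hy
    obtain ⟨x, hx⟩ := Set.mem_iUnion.1 hy
    refine ⟨x, ?_⟩
    have := spectrum.scalar_eq (A := ℝ) (𝕜 := ℝ) (d x)
    simp_all
  rw [cfc_congr (g := q.eval) fun y hy => by
    obtain ⟨x, rfl⟩ := hspec hy
    exact (hqd x).symm,
    cfc_polynomial q _ (isHermitian_diagonalIn U d).isSelfAdjoint,
    Polynomial.aeval_algHom_apply]
  congr 1
  ext x
  have := Polynomial.aeval_algHom_apply (Pi.evalAlgHom ℝ (fun _ : n => ℝ) x) d q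
  simp only [Pi.evalAlgHom_apply] at this
  rw [← this, Function.comp_apply, ← hqd]
  simp [Polynomial.coe_aeval_eq_eval]

theorem trace_mul_diagonalIn (U : Matrix.unitaryGroup n ℂ) (d : n → ℝ) (ρ : Matrix n n ℂ) :
    (ρ * diagonalIn U d).trace = ∑ x, (U.1.conjTranspose * ρ * U.1) x x * (d x : ℂ) := by
  rw [diagonalIn_apply, ← mul_assoc, Matrix.trace_mul_comm, ← mul_assoc, ← mul_assoc]
  simp [Matrix.trace, Matrix.mul_diagonal]

theorem IsHermitian.eq_diagonalIn {ρ : Matrix n n ℂ} (h : ρ.IsHermitian) :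
    ρ = diagonalIn h.eigenvectorUnitary h.eigenvalues := by
  conv_lhs => rw [h.spectral_theorem]
  rfl

theorem sum_normSq_col (W : Matrix.unitaryGroup n ℂ) (x : n) :
    ∑ i, Complex.normSq (W.1 i x) = 1 := by
  have h : (W.1.conjTranspose * W.1) x x = 1 := by
    rw [show W.1.conjTranspose * W.1 = 1 from W.2.1, Matrix.one_apply_eq]
  rw [Matrix.mul_apply] at h
  have h2 : ((∑ i, Complex.normSq (W.1 i x) : ℝ) : ℂ) = 1 := by
    rw [← h]
    push_cast
    refine Finset.sum_congr rfl fun i _ => ?_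
    rw [Complex.normSq_eq_conj_mul_self]; rfl
  exact_mod_cast h2

theorem sum_normSq_row (W : Matrix.unitaryGroup n ℂ) (i : n) :
    ∑ x, Complex.normSq (W.1 i x) = 1 := by
  have := sum_normSq_col (star W) i
  simpa using this

/-- The weights are the squared overlaps of two orthonormal bases; they form a doubly stochastic
matrix, which is what `klein` exploits. -/
theorem conjTranspose_mul_diagonalIn_mul_apply (U V : Matrix.unitaryGroup n ℂ) (d : n → ℝ)
    (x : n) :
    (U.1.conjTranspose * diagonalIn V d * U.1) x x =
      ((∑ i, Complex.normSq ((star V * U).1 i x) * d i : ℝ) : ℂ) := by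
  have h : U.1.conjTranspose * diagonalIn V d * U.1 =
      (star V * U).1.conjTranspose * Matrix.diagonal (fun x => (d x : ℂ)) * (star V * U).1 := by
    simp [diagonalIn_apply, mul_assoc, Matrix.star_eq_conjTranspose]
  rw [h, Matrix.mul_apply]
  push_cast
  refine Finset.sum_congr rfl fun i _ => ?_
  rw [Matrix.mul_diagonal, Complex.normSq_eq_conj_mul_self, Matrix.conjTranspose_apply]
  simp only [RCLike.star_def]
  ring

/-- This is `log x ≤ x - 1` at `x = t / a`. -/
theorem mul_log_sub_log_ge {a t : ℝ} (ha : 0 ≤ a) (ht : 0 < t) :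
    a - t ≤ a * Real.log a - a * Real.log t := by
  rcases ha.eq_or_lt with rfl | ha
  · simpa using ht.le
  have h := Real.log_le_sub_one_of_pos (div_pos ht ha)
  rw [Real.log_div ht.ne' ha.ne'] at h
  have := mul_le_mul_of_nonneg_left h ha.le
  rw [mul_sub, mul_sub, mul_div_cancel₀ _ ha.ne'] at this
  linarith

/-- Klein's inequality: the negative entropy of a state is at least its expectation of the
logarithm of any state that is diagonal in some orthonormal basis. -/
theorem klein {ρ : Matrix n n ℂ} (hρ : ρ.PosSemidef) (hρ1 : ρ.trace = 1)
    (U : Matrix.unitaryGroup n ℂ) (t : n → ℝ) (ht : ∀ x, 0 ≤ t x) (ht1 : ∑ x, t x = 1)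
    (hs : ∀ x, t x = 0 → (U.1.conjTranspose * ρ * U.1) x x = 0) :
    ∑ x, ((U.1.conjTranspose * ρ * U.1) x x).re * Real.log (t x) ≤
      (ρ * cfc Real.log ρ).trace.re := by
  set V := hρ.1.eigenvectorUnitary
  set l := hρ.1.eigenvalues
  have hl (i : n) : 0 ≤ l i := hρ.eigenvalues_nonneg i
  have hV : ρ = diagonalIn V l := IsHermitian.eq_diagonalIn hρ.1
  have hl1 : ∑ i, l i = 1 := by
    have h := hρ.1.trace_eq_sum_eigenvalues
    rw [hρ1] at h
    exact_mod_cast (show ((∑ i, l i : ℝ) : ℂ) = 1 by rw [h]; push_cast; rfl)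
  set w : n → n → ℝ := fun i x => Complex.normSq ((star V * U).1 i x) with hw
  have hw0 (i x : n) : 0 ≤ w i x := Complex.normSq_nonneg _
  have hd (x : n) : (U.1.conjTranspose * ρ * U.1) x x = ((∑ i, w i x * l i : ℝ) : ℂ) := by
    rw [hV, conjTranspose_mul_diagonalIn_mul_apply]
  have hent : (ρ * cfc Real.log ρ).trace.re = ∑ i, l i * Real.log (l i) := by
    rw [hV, cfc_diagonalIn, ← map_mul, ← one_mul (diagonalIn V _), trace_mul_diagonalIn]
    have : V.1.conjTranspose * 1 * V.1 = 1 := by rw [mul_one]; exact V.2.1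
    simp only [this, Matrix.one_apply_eq, one_mul]
    rw [← Complex.ofReal_sum, Complex.ofReal_re]
    rfl
  rw [hent]
  simp only [hd, Complex.ofReal_re]
  -- Summed over `i` and `x`, the left side is `1 - 1 = 0` by double stochasticity. Where `t x = 0`,
  -- the support condition forces every `w i x * l i` to vanish.
  have key (i x : n) : w i x * (l i - t x) ≤
      w i x * (l i * Real.log (l i)) - w i x * l i * Real.log (t x) := by
    rcases (ht x).eq_or_lt with h0 | h0
    · have h := hs x h0.symm
      rw [hd, Complex.ofReal_eq_zero,
        Finset.sum_eq_zero_iff_of_nonneg fun i _ => mul_nonneg (hw0 i x) (hl i)] at h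
      have h := h i (Finset.mem_univ i)
      rw [← h0, sub_zero, ← mul_assoc, h]
      simp
    · have := mul_le_mul_of_nonneg_left (mul_log_sub_log_ge (hl i) h0) (hw0 i x)
      linarith
  have hsum := Finset.sum_le_sum fun i (_ : i ∈ Finset.univ) =>
    Finset.sum_le_sum fun x (_ : x ∈ Finset.univ) => key i x
  simp only [Finset.sum_sub_distrib, mul_sub] at hsum
  have e1 : ∑ i, ∑ x, w i x * l i = 1 := by
    simp_rw [← Finset.sum_mul, hw, sum_normSq_row, one_mul, hl1]
  have e2 : ∑ i, ∑ x, w i x * t x = 1 := by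
    rw [Finset.sum_comm]
    simp_rw [← Finset.sum_mul, hw, sum_normSq_col, one_mul, ht1]
  have e3 : ∑ i, ∑ x, w i x * (l i * Real.log (l i)) = ∑ i, l i * Real.log (l i) := by
    simp_rw [← Finset.sum_mul, hw, sum_normSq_row, one_mul]
  have e4 : ∑ i, ∑ x, w i x * l i * Real.log (t x) =
      ∑ x, (∑ i, w i x * l i) * Real.log (t x) := by
    rw [Finset.sum_comm]
    simp_rw [← Finset.sum_mul]
  linarith

end Spectral

/-! ### One-qubit operators and unitarity of circuits -/

section Sites

variable {V : Type*} [Fintype V] [DecidableEq V]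

theorem onSite_apply_eq_sum (i : V) (A : Matrix (Fin 2) (Fin 2) ℂ) (x z : Bits V) :
    onSite i A x z = ∑ b, if Function.update x i b = z then A (x i) b else 0 := by
  by_cases h : ∀ j, j ≠ i → x j = z j
  · rw [onSite, Matrix.of_apply, if_pos h, Finset.sum_eq_single (z i)]
    · rw [if_pos]
      rw [Function.update_eq_iff]
      exact ⟨rfl, h⟩
    · intro b _ hb
      rw [if_neg]
      rintro rfl
      simp at hb
    · simp
  · rw [onSite, Matrix.of_apply, if_neg h, Finset.sum_eq_zero]
    intro b _
    rw [if_neg]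
    rintro rfl
    exact h fun j hj => by simp [hj]

theorem sum_onSite_mul (i : V) (A : Matrix (Fin 2) (Fin 2) ℂ) (x : Bits V) (f : Bits V → ℂ) :
    ∑ z, onSite i A x z * f z = ∑ b, A (x i) b * f (Function.update x i b) := by
  simp_rw [onSite_apply_eq_sum, Finset.sum_mul, ite_mul, zero_mul]
  rw [Finset.sum_comm]
  simp

theorem onSite_mul (i : V) (A B : Matrix (Fin 2) (Fin 2) ℂ) :
    onSite i A * onSite i B = onSite i (A * B) := by
  ext x y
  rw [Matrix.mul_apply, sum_onSite_mul]
  have h (b : Fin 2) : (∀ j, j ≠ i → Function.update x i b j = y j) ↔ ∀ j, j ≠ i → x j = y j :=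
    forall₂_congr fun j hj => by rw [Function.update_of_ne hj]
  by_cases hxy : ∀ j, j ≠ i → x j = y j
  · simp [onSite, h, if_pos hxy, Matrix.mul_apply]
  · simp [onSite, h, if_neg hxy]

theorem onSite_commute {i j : V} (hij : i ≠ j) (A B : Matrix (Fin 2) (Fin 2) ℂ) :
    Commute (onSite i A) (onSite j B) := by
  have key {i j : V} (hij : i ≠ j) (A B : Matrix (Fin 2) (Fin 2) ℂ) (x y : Bits V) :
      (onSite i A * onSite j B) x y = ∑ b, ∑ c, A (x i) b *
        if Function.update (Function.update x i b) j c = y then B (x j) c else 0 := by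
    simp only [Matrix.mul_apply, sum_onSite_mul]
    simp only [onSite_apply_eq_sum j B, Finset.mul_sum, Function.update_of_ne hij.symm]
  ext x y
  rw [key hij, key hij.symm, Finset.sum_comm]
  refine Finset.sum_congr rfl fun b _ => Finset.sum_congr rfl fun c _ => ?_
  rw [Function.update_comm hij]
  split_ifs <;> ring

theorem onSite_conjTranspose (i : V) (A : Matrix (Fin 2) (Fin 2) ℂ) :
    (onSite i A).conjTranspose = onSite i A.conjTranspose := by
  ext x y
  have h : (∀ j, j ≠ i → y j = x j) ↔ ∀ j, j ≠ i → x j = y j :=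
    forall₂_congr fun j _ => eq_comm
  simp only [onSite, Matrix.conjTranspose_apply, Matrix.of_apply, h]
  split_ifs <;> simp

theorem onSite_diagonal (i : V) (d : Fin 2 → ℂ) :
    onSite i (Matrix.diagonal d) = Matrix.diagonal fun x : Bits V => d (x i) := by
  ext x y
  by_cases h : x = y
  · subst h
    simp [onSite]
  · rw [Matrix.diagonal_apply_ne _ h, onSite, Matrix.of_apply]
    split_ifs with h1
    · refine Matrix.diagonal_apply_ne _ fun h2 => h (funext fun j => ?_)
      by_cases hj : j = i
      · rw [hj, h2]
      · exact h1 j hj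
    · rfl

theorem annihilation_mul_self (i : V) : annihilation i * annihilation i = 0 := by
  have h : (!![0, 1; 0, 0] * !![0, 1; 0, 0] : Matrix (Fin 2) (Fin 2) ℂ) = 0 := by
    ext a b
    fin_cases a <;> fin_cases b <;> simp
  rw [annihilation, onSite_mul, h]
  ext x y
  simp [onSite]

theorem annihilation_conjTranspose (i : V) :
    (annihilation i).conjTranspose = onSite i !![0, 0; 1, 0] := by
  rw [annihilation, onSite_conjTranspose]
  congr 1
  ext a b
  fin_cases a <;> fin_cases b <;> simp

/-- The occupation number of qubit `i`. -/
def number (i : V) : Op V := (annihilation i).conjTranspose * annihilation i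

theorem number_eq_onSite (i : V) : number i = onSite i (Matrix.diagonal ![0, 1]) := by
  rw [number, annihilation_conjTranspose, annihilation, onSite_mul]
  congr 1
  ext a b
  fin_cases a <;> fin_cases b <;> simp

theorem number_eq_diagonal (i : V) :
    number i = Matrix.diagonal fun x : Bits V => (![0, 1] : Fin 2 → ℂ) (x i) := by
  rw [number_eq_onSite, onSite_diagonal]

theorem annihilation_mul_conjTranspose_add (i : V) :
    annihilation i * (annihilation i).conjTranspose +
      (annihilation i).conjTranspose * annihilation i = 1 := by
  have h : annihilation i * (annihilation i).conjTranspose =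
      onSite i (Matrix.diagonal ![1, 0]) := by
    rw [annihilation_conjTranspose, annihilation, onSite_mul]
    congr 1
    ext a b
    fin_cases a <;> fin_cases b <;> simp
  rw [h, ← number, number_eq_diagonal, onSite_diagonal, Matrix.diagonal_add,
    ← Matrix.diagonal_one]
  congr 1
  ext x
  generalize x i = b
  fin_cases b <;> simp

theorem annihilation_commute_number {i j : V} (h : i ≠ j) :
    Commute (annihilation i) (number j) := by
  rw [number_eq_onSite]
  exact onSite_commute h _ _

/-- Splitting a bit string into its parts inside and outside `s` exhibits `A ⊗ 1`, from which
unitarity is inherited. -/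
theorem extend_eq_kronecker (s : Finset V) (A : Matrix (s → Fin 2) (s → Fin 2) ℂ) :
    extend s A = (Matrix.kronecker A (1 : Matrix ({j // j ∉ s} → Fin 2) _ ℂ)).submatrix
      (Equiv.piEquivPiSubtypeProd (· ∈ s) fun _ => Fin 2)
      (Equiv.piEquivPiSubtypeProd (· ∈ s) fun _ => Fin 2) := by
  ext x y
  have h : (∀ j, j ∉ s → x j = y j) ↔
      (fun j : {j // j ∉ s} => x j) = fun j : {j // j ∉ s} => y j := by
    simp [funext_iff]
  simp only [extend, Matrix.of_apply, h, Matrix.submatrix_apply, Matrix.kronecker,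
    Matrix.kroneckerMap_apply, Matrix.one_apply, Equiv.piEquivPiSubtypeProd_apply, mul_ite, mul_one,
    mul_zero]

theorem extend_mem_unitaryGroup (s : Finset V) (A : Matrix.unitaryGroup (s → Fin 2) ℂ) :
    extend s A.1 ∈ Matrix.unitaryGroup (Bits V) ℂ := by
  have h : A.1 * A.1.conjTranspose = 1 := A.2.2
  rw [Matrix.mem_unitaryGroup_iff, Matrix.star_eq_conjTranspose, extend_eq_kronecker,
    Matrix.conjTranspose_submatrix, Matrix.submatrix_mul_equiv, Matrix.kronecker,
    Matrix.conjTranspose_kronecker, ← Matrix.mul_kronecker_mul, h]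
  simp

theorem Circuit.op_mem_unitaryGroup {G : SimpleGraph V} {L : ℕ} (C : Circuit G L) :
    C.op ∈ Matrix.unitaryGroup (Bits V) ℂ := by
  refine Submonoid.list_prod_mem _ fun A hA => ?_
  obtain ⟨l, rfl⟩ := (List.mem_ofFn' _ _).1 hA
  refine Submonoid.list_prod_mem _ fun B hB => ?_
  obtain ⟨g, -, rfl⟩ := List.mem_map.1 hB
  exact extend_mem_unitaryGroup _ _

end Sites

/-! ### Scalar inequalities -/

section Scalars

/-- The sum of `log` and the polynomial has derivative `(1 - s)² / s ≥ 0` and vanishes at `1`. -/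
theorem neg_log_ge {s : ℝ} (hs : 0 < s) (hs1 : s ≤ 1) :
    (3 - 4 * s + s ^ 2) / 2 ≤ -Real.log s := by
  have hd : ∀ x ∈ interior (Set.Ioc (0 : ℝ) 1),
      HasDerivWithinAt (fun x => Real.log x + (3 - 4 * x + x ^ 2) / 2)
        (x⁻¹ + (-4 + 2 * x) / 2) (interior (Set.Ioc (0 : ℝ) 1)) x := by
    intro x hx
    rw [interior_Ioc] at hx
    have h1 := Real.hasDerivAt_log hx.1.ne'
    have h2 : HasDerivAt (fun x : ℝ => (3 - 4 * x + x ^ 2) / 2) ((-4 + 2 * x) / 2) x := by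
      refine (((((hasDerivAt_id' x).const_mul 4).const_sub 3).fun_add
        (hasDerivAt_pow 2 x)).div_const 2).congr_deriv ?_
      norm_num
    exact (h1.add h2).hasDerivWithinAt
  have hm : MonotoneOn (fun x => Real.log x + (3 - 4 * x + x ^ 2) / 2) (Set.Ioc (0 : ℝ) 1) := by
    refine monotoneOn_of_hasDerivWithinAt_nonneg (convex_Ioc 0 1) ?_ hd ?_
    · refine ContinuousOn.add (Real.continuousOn_log.mono fun x hx => hx.1.ne') ?_
      fun_prop
    · intro x hx
      rw [interior_Ioc] at hx
      have : x⁻¹ + (-4 + 2 * x) / 2 = (1 - x) ^ 2 / x := by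
        have := hx.1.ne'
        field_simp
        ring
      rw [this]
      exact div_nonneg (sq_nonneg _) hx.1.le
  have := hm ⟨hs, hs1⟩ ⟨one_pos, le_rfl⟩ hs1
  norm_num at this
  linarith

/-- A lower bound on the binary relative entropy by a one-sided Hellinger distance. -/
theorem binary_relEntropy_ge {p q : ℝ} (hp : p ≤ 1) (hq0 : 0 < q) (hq : q < 1) :
    2 * max (√p - √q) 0 ^ 2 ≤ p * (Real.log (max p q) - Real.log q) +
      (1 - p) * (Real.log (1 - max p q) - Real.log (1 - q)) := by
  rcases le_or_gt p q with h | h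
  · rw [max_eq_right h, max_eq_right (sub_nonpos.2 (Real.sqrt_le_sqrt h))]
    simp
  · rw [max_eq_left h.le, max_eq_left (sub_nonneg.2 (Real.sqrt_le_sqrt h.le))]
    have hp' : 0 < p := hq0.trans h
    have hsp : 0 < √p := Real.sqrt_pos.2 hp'
    have hsq : 0 < √q := Real.sqrt_pos.2 hq0
    -- At `s = √q / √p`, multiplied by `2p`, this gives `p log (p/q) ≥ 3p - 4√p√q + q`. The other
    -- term is at least `q - p`, and the sum is `2(√p - √q)²`.
    have h1 := neg_log_ge (div_pos hsq hsp) ((div_le_one hsp).2 (Real.sqrt_le_sqrt h.le))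
    rw [Real.log_div hsq.ne' hsp.ne', Real.log_sqrt hp'.le, Real.log_sqrt hq0.le] at h1
    have h2 := mul_le_mul_of_nonneg_left h1 (mul_nonneg two_pos.le hp'.le)
    have e1 : 2 * p * ((3 - 4 * (√q / √p) + (√q / √p) ^ 2) / 2) = 3 * p - 4 * (√p * √q) + q := by
      have ep := Real.sq_sqrt hp'.le
      have eq := Real.sq_sqrt hq0.le
      conv_lhs => enter [1, 2]; rw [← ep]
      field_simp
      rw [eq]
      linear_combination 3 * ep
    have h3 := mul_log_sub_log_ge (sub_nonneg.2 hp) (sub_pos.2 hq)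
    have ep := Real.sq_sqrt hp'.le
    have eq := Real.sq_sqrt hq0.le
    rw [e1] at h2
    nlinarith

theorem sqrt_two_mul_le {p ε : ℝ} (hε : 0 < ε) :
    √(2 * p) ≤ √ε + √(2 * max (√p - √(ε ^ 2 / (1 + ε ^ 2))) 0 ^ 2) := by
  set q := ε ^ 2 / (1 + ε ^ 2)
  -- That is, `2ε²/(1+ε²) ≤ ε`, which is `(ε - 1)² ≥ 0`.
  have h1 : √2 * √q ≤ √ε := by
    rw [← Real.sqrt_mul two_pos.le]
    refine Real.sqrt_le_sqrt ?_
    rw [← mul_div_assoc, div_le_iff₀ (by positivity)]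
    nlinarith [sq_nonneg (ε - 1)]
  rw [Real.sqrt_mul two_pos.le, Real.sqrt_mul two_pos.le, Real.sqrt_sq (le_max_right _ _)]
  have := mul_le_mul_of_nonneg_left (le_max_left (√p - √q) 0) (Real.sqrt_nonneg 2)
  linarith

/-- A consequence of Minkowski's inequality in `ℓ²`. -/
theorem sqrt_sum_le {ι : Type*} (s : Finset ι) {f d : ι → ℝ} {ε : ℝ} (hε : 0 ≤ ε)
    (hf : ∀ i ∈ s, 0 ≤ f i) (hd : ∀ i ∈ s, 0 ≤ d i) (h : ∀ i ∈ s, √(f i) ≤ √ε + √(d i)) :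
    √(∑ i ∈ s, f i) ≤ √(ε * s.card) + √(∑ i ∈ s, d i) := by
  have hm := Real.Lp_add_le_of_nonneg s (p := 2) (by norm_num)
    (fun i _ => Real.sqrt_nonneg ε) (fun i (_ : i ∈ s) => Real.sqrt_nonneg (d i))
  simp only [Real.rpow_ofNat, ← Real.sqrt_eq_rpow] at hm
  rw [Finset.sum_congr rfl fun i hi => Real.sq_sqrt (hd i hi)] at hm
  simp only [Real.sq_sqrt hε, Finset.sum_const, nsmul_eq_mul] at hm
  rw [mul_comm ε]
  refine le_trans (Real.sqrt_le_sqrt (Finset.sum_le_sum fun i hi => ?_)) hm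
  rw [← Real.sq_sqrt (hf i hi)]
  exact pow_le_pow_left₀ (Real.sqrt_nonneg _) (h i hi) 2

end Scalars

/-! ### Operator norm and the Hilbert–Schmidt inner product -/

section OpNorm

variable {V : Type*} [Fintype V] [DecidableEq V]

theorem opNorm_nonneg (A : Op V) : 0 ≤ opNorm A := norm_nonneg _

theorem opNorm_mul_le (A B : Op V) : opNorm (A * B) ≤ opNorm A * opNorm B := by
  rw [opNorm, map_mul]
  exact norm_mul_le _ _

theorem opNorm_add_le (A B : Op V) : opNorm (A + B) ≤ opNorm A + opNorm B := by
  rw [opNorm, map_add]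
  exact norm_add_le _ _

theorem opNorm_neg (A : Op V) : opNorm (-A) = opNorm A := by
  rw [opNorm, map_neg, norm_neg, opNorm]

theorem opNorm_conjTranspose (A : Op V) : opNorm A.conjTranspose = opNorm A := by
  open scoped Matrix.Norms.L2Operator in
  exact Matrix.l2_opNorm_conjTranspose A

theorem opNorm_conjTranspose_mul_self (A : Op V) :
    opNorm (A.conjTranspose * A) = opNorm A * opNorm A := by
  open scoped Matrix.Norms.L2Operator in
  exact Matrix.l2_opNorm_conjTranspose_mul_self A

theorem opNorm_le_one_of_projection {P : Op V} (h : P.IsHermitian) (hP : P * P = P) :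
    opNorm P ≤ 1 := by
  have h1 := opNorm_conjTranspose_mul_self P
  rw [h.eq, hP] at h1
  nlinarith [opNorm_nonneg P]

theorem opNorm_one_le : opNorm (1 : Op V) ≤ 1 :=
  opNorm_le_one_of_projection Matrix.isHermitian_one (mul_one _)

theorem opNorm_unitary_le (U : Matrix.unitaryGroup (Bits V) ℂ) : opNorm U.1 ≤ 1 := by
  have h1 := opNorm_conjTranspose_mul_self U.1
  rw [show U.1.conjTranspose * U.1 = 1 from U.2.1] at h1
  nlinarith [opNorm_nonneg U.1, opNorm_one_le (V := V)]

theorem opNorm_conj_conjTranspose_le (U : Matrix.unitaryGroup (Bits V) ℂ) (A : Op V) :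
    opNorm (U.1.conjTranspose * A * U.1) ≤ opNorm A := by
  have h := opNorm_unitary_le U
  have h' := opNorm_conjTranspose U.1 ▸ h
  have h0 := opNorm_nonneg A
  calc _ ≤ opNorm U.1.conjTranspose * opNorm A * opNorm U.1 :=
        (opNorm_mul_le _ _).trans
          (mul_le_mul_of_nonneg_right (opNorm_mul_le _ _) (opNorm_nonneg _))
    _ ≤ 1 * opNorm A * 1 := by
        gcongr
        exact opNorm_nonneg _
    _ = opNorm A := by ring

/-- The columns of a matrix, as vectors of the Hilbert space. -/
noncomputable def column (X : Op V) (j : Bits V) : EuclideanSpace ℂ (Bits V) :=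
  WithLp.toLp 2 fun i => X i j

theorem trace_conjTranspose_mul (X Y : Op V) :
    (X.conjTranspose * Y).trace = ∑ j, inner ℂ (column X j) (column Y j) := by
  refine Finset.sum_congr rfl fun j _ => ?_
  rw [Matrix.diag_apply, Matrix.mul_apply, PiLp.inner_apply]
  refine Finset.sum_congr rfl fun i _ => ?_
  simp [column, mul_comm]

theorem sum_norm_column_sq (X : Op V) :
    ∑ j, ‖column X j‖ ^ 2 = (X.conjTranspose * X).trace.re := by
  rw [trace_conjTranspose_mul, Complex.re_sum]
  refine Finset.sum_congr rfl fun j _ => ?_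
  rw [inner_self_eq_norm_sq_to_K]
  norm_cast

theorem norm_column_mul_le (M X : Op V) (j : Bits V) :
    ‖column (M * X) j‖ ≤ opNorm M * ‖column X j‖ := by
  have : column (M * X) j = Matrix.toEuclideanCLM (n := Bits V) (𝕜 := ℂ) M (column X j) := by
    rw [column, column, Matrix.toEuclideanCLM_toLp]
    rfl
  rw [this]
  exact ContinuousLinearMap.le_opNorm _ _

/-- With `ρ = B B†` the trace is the Hilbert–Schmidt product of `a B` and `M B`; Cauchy–Schwarz
applies, and `B` has Hilbert–Schmidt norm `1`. -/
theorem norm_trace_conjTranspose_mul_mul_le (a M : Op V) {ρ : Op V} (hρ : IsState ρ) :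
    ‖(a.conjTranspose * M * ρ).trace‖ ≤ opNorm M * √(a.conjTranspose * a * ρ).trace.re := by
  obtain ⟨B, hB⟩ : ∃ B : Op V, ρ = B * B.conjTranspose := by
    refine ⟨diagonalIn hρ.1.1.eigenvectorUnitary fun x => √(hρ.1.1.eigenvalues x), ?_⟩
    rw [(isHermitian_diagonalIn _ _).eq, ← map_mul]
    conv_lhs => rw [IsHermitian.eq_diagonalIn hρ.1.1]
    congr 1
    ext x
    exact (Real.mul_self_sqrt (hρ.1.eigenvalues_nonneg x)).symm
  have h1 : (a.conjTranspose * M * ρ).trace = ((a * B).conjTranspose * (M * B)).trace := by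
    rw [hB, ← mul_assoc, Matrix.trace_mul_comm, Matrix.conjTranspose_mul]
    simp only [mul_assoc]
  have h2 : (a.conjTranspose * a * ρ).trace.re = ∑ j, ‖column (a * B) j‖ ^ 2 := by
    rw [sum_norm_column_sq, hB, ← mul_assoc, Matrix.trace_mul_comm, Matrix.conjTranspose_mul]
    simp only [mul_assoc]
  have h3 : ∑ j, ‖column B j‖ ^ 2 = 1 := by
    rw [sum_norm_column_sq, Matrix.trace_mul_comm, ← hB, hρ.2, Complex.one_re]
  have h4 := Real.sum_mul_le_sqrt_mul_sqrt Finset.univ (fun j => ‖column (a * B) j‖)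
    fun j => ‖column B j‖
  rw [h3, Real.sqrt_one, mul_one, ← h2] at h4
  rw [h1, trace_conjTranspose_mul]
  calc _ ≤ ∑ j, ‖inner ℂ (column (a * B) j) (column (M * B) j)‖ := norm_sum_le _ _
    _ ≤ ∑ j, opNorm M * (‖column (a * B) j‖ * ‖column B j‖) := by
        refine Finset.sum_le_sum fun j _ => (norm_inner_le_norm _ _).trans ?_
        rw [mul_left_comm]
        exact mul_le_mul_of_nonneg_left (norm_column_mul_le _ _ _) (norm_nonneg _)
    _ = opNorm M * ∑ j, ‖column (a * B) j‖ * ‖column B j‖ := by rw [Finset.mul_sum]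
    _ ≤ _ := mul_le_mul_of_nonneg_left h4 (opNorm_nonneg _)

end OpNorm

/-! ### The cost of resetting one qubit -/

section Reset

variable {V : Type*} [Fintype V] [DecidableEq V]

/-- For `a` the annihilation operator of a qubit, the channel that resets this qubit to `|0⟩`. -/
def reset (a ρ : Op V) : Op V :=
  a * a.conjTranspose * ρ * (a * a.conjTranspose) + a * ρ * a.conjTranspose

variable {a : Op V}

theorem trace_mul_reset (a A ρ : Op V) :
    (A * reset a ρ).trace = ((a * a.conjTranspose * A * (a * a.conjTranspose) +
      a.conjTranspose * A * a) * ρ).trace := by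
  rw [reset, mul_add, add_mul, Matrix.trace_add, Matrix.trace_add]
  congr 1
  · rw [← mul_assoc, Matrix.trace_mul_comm]
    simp only [mul_assoc]
  · rw [← mul_assoc, Matrix.trace_mul_comm]
    simp only [mul_assoc]

theorem mul_conjTranspose_projection (h0 : a * a = 0)
    (h1 : a * a.conjTranspose + a.conjTranspose * a = 1) :
    a * a.conjTranspose * (a * a.conjTranspose) = a * a.conjTranspose := by
  have h := congrArg (a * a.conjTranspose * ·) h1
  simp only [mul_add, mul_one] at h
  have h2 : a * a.conjTranspose * (a.conjTranspose * a) = 0 := by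
    have : a.conjTranspose * a.conjTranspose = 0 := by
      rw [← Matrix.conjTranspose_mul, h0, Matrix.conjTranspose_zero]
    rw [mul_assoc, ← mul_assoc a.conjTranspose, this, zero_mul, mul_zero]
  rwa [h2, add_zero] at h

theorem IsState.reset {ρ : Op V} (hρ : IsState ρ) (h0 : a * a = 0)
    (h1 : a * a.conjTranspose + a.conjTranspose * a = 1) : IsState (reset a ρ) := by
  constructor
  · refine Matrix.PosSemidef.add ?_ (hρ.1.mul_mul_conjTranspose_same a)
    have := hρ.1.mul_mul_conjTranspose_same (a * a.conjTranspose)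
    rwa [Matrix.conjTranspose_mul, Matrix.conjTranspose_conjTranspose] at this
  · have h := trace_mul_reset a 1 ρ
    rw [one_mul, mul_one, mul_one, mul_conjTranspose_projection h0 h1, h1, one_mul] at h
    rw [h, hρ.2]

/-- Put `P = a a†`, so `a† a = 1 - P`. As `a² = 0`, `a† [O, a] (1 + P) = a† O a - (1 - P) O (1 +
P)`; adding the adjoint, the last terms combine into `2O - 2POP`. The factor `a†` on the left is
what later yields the square root of the occupation. -/
theorem sub_reset_adjoint_eq (h0 : a * a = 0)
    (h1 : a * a.conjTranspose + a.conjTranspose * a = 1) {O : Op V} (hO : O.IsHermitian) :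
    2 * (O - (a * a.conjTranspose * O * (a * a.conjTranspose) + a.conjTranspose * O * a)) =
      -(a.conjTranspose * (comm O a * (1 + a * a.conjTranspose)) +
        (a.conjTranspose * (comm O a * (1 + a * a.conjTranspose))).conjTranspose) := by
  set b := a.conjTranspose with hb
  have hbb : b.conjTranspose = a := Matrix.conjTranspose_conjTranspose a
  have hP : b * a = 1 - a * b := eq_sub_of_add_eq' h1
  have e1 : b * (comm O a * (1 + a * b)) = b * O * a - b * a * O * (1 + a * b) := by
    have : b * (comm O a * (1 + a * b)) =
      b * O * a + b * O * (a * a) * b - b * a * O * (1 + a * b) := by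
      rw [comm]; noncomm_ring
    rw [this, h0]; simp
  have e2 : (b * (comm O a * (1 + a * b))).conjTranspose =
      b * O * a - (1 + a * b) * O * (b * a) := by
    rw [e1]
    simp only [Matrix.conjTranspose_sub, Matrix.conjTranspose_mul, Matrix.conjTranspose_add,
      Matrix.conjTranspose_one, hbb, hO.eq, ← hb, mul_assoc]
  rw [e2, e1, hP]
  noncomm_ring

/-- Resetting a qubit changes expectation values by at most the commutator norm times the square
root of the occupation of this qubit. -/
theorem norm_trace_sub_reset_le (h0 : a * a = 0)
    (h1 : a * a.conjTranspose + a.conjTranspose * a = 1) {O : Op V} (hO : O.IsHermitian)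
    {ρ : Op V} (hρ : IsState ρ) :
    ‖(O * ρ).trace - (O * reset a ρ).trace‖ ≤
      2 * opNorm (comm O a) * √(a.conjTranspose * a * ρ).trace.re := by
  set M := comm O a * (1 + a * a.conjTranspose) with hM
  have hbound := norm_trace_conjTranspose_mul_mul_le a M hρ
  have hMn : opNorm M ≤ 2 * opNorm (comm O a) := by
    have hP : opNorm (a * a.conjTranspose) ≤ 1 :=
      opNorm_le_one_of_projection (Matrix.isHermitian_mul_conjTranspose_self a)
        (mul_conjTranspose_projection h0 h1)
    have h2 : opNorm (1 + a * a.conjTranspose) ≤ 2 := by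
      linarith [opNorm_add_le 1 (a * a.conjTranspose), opNorm_one_le (V := V)]
    calc opNorm M ≤ _ := opNorm_mul_le _ _
      _ ≤ opNorm (comm O a) * 2 := mul_le_mul_of_nonneg_left h2 (opNorm_nonneg _)
      _ = _ := mul_comm _ _
  have htr : ((a.conjTranspose * M).conjTranspose * ρ).trace =
      star (a.conjTranspose * M * ρ).trace := by
    rw [← Matrix.trace_conjTranspose, Matrix.conjTranspose_mul (a.conjTranspose * M), hρ.1.1.eq,
      Matrix.trace_mul_comm]
  have hid : 2 * ((O * ρ).trace - (O * reset a ρ).trace) =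
      -((a.conjTranspose * M * ρ).trace + star (a.conjTranspose * M * ρ).trace) := by
    rw [trace_mul_reset, ← Matrix.trace_sub, ← sub_mul, ← htr, ← Matrix.trace_add, ← add_mul,
      ← Matrix.trace_neg, ← neg_mul, hM, ← sub_reset_adjoint_eq h0 h1 hO, two_mul,
      two_mul, add_mul, Matrix.trace_add]
  have hn := congrArg norm hid
  rw [norm_mul, norm_neg] at hn
  have h2 := norm_add_le (a.conjTranspose * M * ρ).trace (star (a.conjTranspose * M * ρ).trace)
  rw [norm_star] at h2
  have h3 := mul_le_mul_of_nonneg_right hMn (Real.sqrt_nonneg (a.conjTranspose * a * ρ).trace.re)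
  rw [show ‖(2 : ℂ)‖ = 2 by norm_num] at hn
  linarith

end Reset

/-! ### Occupation numbers, the Gibbs state and relative entropy -/

section Entropy

variable {V : Type*} [Fintype V] [DecidableEq V]

/-- The expected occupation number of qubit `i`. -/
def occupation (i : V) (ρ : Op V) : ℝ := (number i * ρ).trace.re

theorem occupation_eq_sum (i : V) (ρ : Op V) :
    occupation i ρ = ∑ x : Bits V, if x i = 1 then (ρ x x).re else 0 := by
  rw [occupation, number_eq_diagonal, Matrix.trace, Complex.re_sum]
  refine Finset.sum_congr rfl fun x _ => ?_
  rw [Matrix.diag_apply, Matrix.diagonal_mul]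
  generalize x i = b
  fin_cases b <;> simp

theorem IsState.re_diag_nonneg {ρ : Op V} (hρ : IsState ρ) (x : Bits V) : 0 ≤ (ρ x x).re :=
  (Complex.le_def.1 hρ.1.diag_nonneg).1

theorem IsState.diag_eq_re {ρ : Op V} (hρ : IsState ρ) (x : Bits V) :
    ρ x x = ((ρ x x).re : ℂ) :=
  Complex.ext rfl (Complex.le_def.1 hρ.1.diag_nonneg).2.symm

theorem IsState.sum_re_diag {ρ : Op V} (hρ : IsState ρ) : ∑ x, (ρ x x).re = 1 := by
  have := congrArg Complex.re hρ.2
  rwa [Matrix.trace, Complex.re_sum] at this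

theorem IsState.one_sub_occupation {ρ : Op V} (hρ : IsState ρ) (i : V) :
    1 - occupation i ρ = ∑ x : Bits V, if x i = 0 then (ρ x x).re else 0 := by
  rw [occupation_eq_sum, ← hρ.sum_re_diag, ← Finset.sum_sub_distrib]
  refine Finset.sum_congr rfl fun x _ => ?_
  generalize x i = b
  fin_cases b <;> simp

theorem IsState.occupation_nonneg {ρ : Op V} (hρ : IsState ρ) (i : V) : 0 ≤ occupation i ρ := by
  rw [occupation_eq_sum]
  refine Finset.sum_nonneg fun x _ => ?_
  split_ifs
  exacts [hρ.re_diag_nonneg x, le_rfl]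

theorem IsState.occupation_le_one {ρ : Op V} (hρ : IsState ρ) (i : V) : occupation i ρ ≤ 1 := by
  rw [← sub_nonneg, hρ.one_sub_occupation]
  refine Finset.sum_nonneg fun x _ => ?_
  split_ifs
  exacts [hρ.re_diag_nonneg x, le_rfl]

theorem IsState.conj {ρ : Op V} (hρ : IsState ρ) (U : Matrix.unitaryGroup (Bits V) ℂ) :
    IsState (U.1.conjTranspose * ρ * U.1) := by
  refine ⟨hρ.1.conjTranspose_mul_mul_same _, ?_⟩
  rw [Matrix.trace_mul_comm, ← mul_assoc, show U.1 * U.1.conjTranspose = 1 from U.2.2, one_mul,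
    hρ.2]

/-- A product weight on bit strings. -/
def productWeight (g : V → Fin 2 → ℝ) (x : Bits V) : ℝ := ∏ i, g i (x i)

theorem sum_productWeight (g : V → Fin 2 → ℝ) :
    ∑ x, productWeight g x = ∏ i, (g i 0 + g i 1) := by
  simp_rw [productWeight, ← Fin.sum_univ_two, Fintype.prod_sum]

/-- The logarithm of a nonzero product splits into one-site terms, whose averages see only the
one-site marginals of the diagonal of `ρ`. -/
theorem IsState.sum_mul_log_productWeight {ρ : Op V} (hρ : IsState ρ) (g : V → Fin 2 → ℝ)
    (hg : ∀ x, productWeight g x = 0 → (ρ x x).re = 0) :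
    ∑ x, (ρ x x).re * Real.log (productWeight g x) =
      ∑ i, ((1 - occupation i ρ) * Real.log (g i 0) + occupation i ρ * Real.log (g i 1)) := by
  have h (x : Bits V) : (ρ x x).re * Real.log (productWeight g x) =
      ∑ i, (ρ x x).re * Real.log (g i (x i)) := by
    by_cases hx : productWeight g x = 0
    · simp [hg x hx]
    · rw [productWeight, Real.log_prod, Finset.mul_sum]
      exact fun i _ => Finset.prod_ne_zero_iff.1 hx i (Finset.mem_univ i)
  simp_rw [h]
  rw [Finset.sum_comm]
  refine Finset.sum_congr rfl fun i _ => ?_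
  rw [hρ.one_sub_occupation, occupation_eq_sum, Finset.sum_mul, Finset.sum_mul,
    ← Finset.sum_add_distrib]
  refine Finset.sum_congr rfl fun x _ => ?_
  generalize x i = b
  fin_cases b <;> simp

theorem exp_diagonalIn {n : Type*} [Fintype n] [DecidableEq n] (U : Matrix.unitaryGroup n ℂ)
    (d : n → ℝ) : NormedSpace.exp (diagonalIn U d) = diagonalIn U fun x => Real.exp (d x) := by
  have hU : U.1⁻¹ = U.1.conjTranspose := Matrix.inv_eq_right_inv U.2.2
  have hu : IsUnit U.1 := ⟨⟨U.1, U.1.conjTranspose, U.2.2, U.2.1⟩, rfl⟩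
  rw [diagonalIn_apply, ← hU, Matrix.exp_conj _ _ hu, Matrix.exp_diagonal, diagonalIn_apply, hU]
  congr 3
  ext x
  rw [Pi.coe_exp, ← Complex.exp_eq_exp_ℂ, Complex.ofReal_exp]

theorem trace_diagonalIn {n : Type*} [Fintype n] [DecidableEq n] (U : Matrix.unitaryGroup n ℂ)
    (d : n → ℝ) : (diagonalIn U d).trace = ((∑ x, d x : ℝ) : ℂ) := by
  rw [← one_mul (diagonalIn U d), trace_mul_diagonalIn, mul_one,
    show U.1.conjTranspose * U.1 = 1 from U.2.1]
  simp

theorem smul_hamiltonian (U : Matrix.unitaryGroup (Bits V) ℂ) (β : ℝ) :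
    -(β : ℂ) • hamiltonian U.1 =
      diagonalIn U fun x => ∑ i, β * (![1, -1] : Fin 2 → ℝ) (x i) := by
  have hZ (i : V) : conj U.1 (pauliZ i) =
      diagonalIn U fun x => (![1, -1] : Fin 2 → ℝ) (x i) := by
    have h : (!![1, 0; 0, -1] : Matrix (Fin 2) (Fin 2) ℂ) = Matrix.diagonal ![1, -1] := by
      ext a b
      fin_cases a <;> fin_cases b <;> simp
    rw [conj, pauliZ, h, onSite_diagonal, diagonalIn_apply]
    congr 3
    ext x
    generalize x i = b
    fin_cases b <;> simp
  have hs : (fun x : Bits V => ∑ i, β * (![1, -1] : Fin 2 → ℝ) (x i)) =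
      β • ∑ i, fun x : Bits V => (![1, -1] : Fin 2 → ℝ) (x i) := by
    ext x
    simp [Finset.mul_sum]
  rw [hs, map_smul, map_sum, hamiltonian, smul_neg, neg_smul, neg_neg]
  simp_rw [hZ]
  rfl

/-- The Gibbs weights of a qubit with Hamiltonian `-Z` at inverse temperature `log (1 / ε)`. -/
noncomputable def gibbsWeight (ε : ℝ) : Fin 2 → ℝ := ![1 - ε ^ 2 / (1 + ε ^ 2), ε ^ 2 / (1 + ε ^ 2)]

theorem sigma_eq_diagonalIn (U : Matrix.unitaryGroup (Bits V) ℂ) {ε : ℝ} (hε : 0 < ε) :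
    sigma U.1 ε = diagonalIn U (productWeight fun _ => gibbsWeight ε) := by
  -- Before normalization a qubit has weights `ε⁻¹` and `ε`; dividing by `ε⁻¹ + ε` gives
  -- `gibbsWeight`.
  have he : (fun x : Bits V =>
      Real.exp (∑ i, Real.log ε⁻¹ * (![1, -1] : Fin 2 → ℝ) (x i))) =
      productWeight fun _ => ![ε⁻¹, ε] := by
    ext x
    rw [Real.exp_sum]
    refine Finset.prod_congr rfl fun i _ => ?_
    generalize x i = b
    fin_cases b
    · simp [Real.exp_neg, Real.exp_log hε]
    · simp [Real.exp_log hε]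
  rw [sigma, gibbs, smul_hamiltonian, exp_diagonalIn, he, trace_diagonalIn, sum_productWeight,
    ← Complex.ofReal_inv, Complex.coe_smul, ← map_smul]
  congr 1
  ext x
  rw [Pi.smul_apply, smul_eq_mul, productWeight, productWeight, ← Finset.prod_inv_distrib,
    ← Finset.prod_mul_distrib]
  refine Finset.prod_congr rfl fun i _ => ?_
  have h1 : (1 + ε ^ 2) ≠ 0 := by positivity
  have h2 : ε⁻¹ + ε ≠ 0 := by positivity
  have h3 : ε ≠ 0 := hε.ne'
  generalize x i = b
  fin_cases b
  · simp [gibbsWeight]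
    field_simp
    ring
  · simp [gibbsWeight]
    field_simp

theorem gibbsWeight_pos {ε : ℝ} (hε : 0 < ε) (b : Fin 2) : 0 < gibbsWeight ε b := by
  have h : ε ^ 2 / (1 + ε ^ 2) < 1 := (div_lt_one (by positivity)).2 (by linarith)
  fin_cases b
  · simpa [gibbsWeight] using h
  · simp only [gibbsWeight, Fin.mk_one, Matrix.cons_val_one, Matrix.cons_val_zero]
    positivity

theorem relEntropy_sigma (U : Matrix.unitaryGroup (Bits V) ℂ) {ε : ℝ} (hε : 0 < ε) (ρ : Op V) :
    relEntropy ρ (sigma U.1 ε) =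
      (((ρ * (cfc Real.log ρ - cfc Real.log (sigma U.1 ε))).trace.re : ℝ) : EReal) := by
  rw [relEntropy, if_pos]
  intro v hv
  set w := productWeight (V := V) fun _ => gibbsWeight ε
  have h : diagonalIn U w⁻¹ * sigma U.1 ε = 1 := by
    rw [sigma_eq_diagonalIn U hε, ← map_mul, ← map_one (diagonalIn U)]
    congr 1
    ext x
    exact inv_mul_cancel₀ (Finset.prod_pos fun i _ => gibbsWeight_pos hε _).ne'
  have hv0 : v = 0 := by
    rw [← Matrix.one_mulVec v, ← h, ← Matrix.mulVec_mulVec, hv, Matrix.mulVec_zero]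
  rw [hv0, Matrix.mulVec_zero]

/-- The relative entropy with respect to the Gibbs state controls the occupation numbers. -/
theorem sum_hellinger_le_relEntropy (U : Matrix.unitaryGroup (Bits V) ℂ) {ε : ℝ} (hε : 0 < ε)
    {ρ : Op V} (hρ : IsState ρ) :
    ∑ i, 2 * max (√(occupation i (U.1.conjTranspose * ρ * U.1)) - √(ε ^ 2 / (1 + ε ^ 2))) 0 ^ 2 ≤
      (relEntropy ρ (sigma U.1 ε)).toReal := by
  have hr := hρ.conj U
  set r := U.1.conjTranspose * ρ * U.1 with hrdef
  set q := ε ^ 2 / (1 + ε ^ 2) with hq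
  have hq0 : 0 < q := by positivity
  have hq1 : q < 1 := (div_lt_one (by positivity)).2 (by linarith)
  -- Trial state for Klein's inequality. The maximum with `q` makes sites with occupation at most
  -- `q` agree with the Gibbs state and contribute zero.
  set g : V → Fin 2 → ℝ := fun i => ![1 - max (occupation i r) q, max (occupation i r) q] with hg
  have hg0 (i : V) (b : Fin 2) : 0 ≤ g i b := by
    fin_cases b
    · simp only [hg, Fin.zero_eta, Matrix.cons_val_zero, sub_nonneg]
      exact max_le (hr.occupation_le_one i) hq1.le
    · exact hq0.le.trans (le_max_right _ _)
  have hsupp (x : Bits V) (hx : productWeight g x = 0) : (r x x).re = 0 := by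
    obtain ⟨i, -, hi⟩ := Finset.prod_eq_zero_iff.1 hx
    have hx0 : x i = 0 := by
      by_contra h
      rw [Fin.eq_one_of_ne_zero _ h] at hi
      exact (hq0.trans_le (le_max_right (occupation i r) q)).ne' hi
    rw [hx0] at hi
    -- As `q < 1`, a maximum equal to `1` must be the occupation; then `r` has no diagonal weight on
    -- strings with `x i = 0`.
    have hp : 1 - occupation i r = 0 := by
      have h1 : max (occupation i r) q = 1 := (sub_eq_zero.1 hi).symm
      rcases max_choice (occupation i r) q with h | h <;> linarith
    rw [hr.one_sub_occupation, Finset.sum_eq_zero_iff_of_nonneg] at hp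
    · simpa [hx0] using hp x (Finset.mem_univ x)
    · intro y _
      split_ifs
      exacts [hr.re_diag_nonneg y, le_rfl]
  have hk := klein hρ.1 hρ.2 U (productWeight g) (fun x => Finset.prod_nonneg fun i _ => hg0 i _)
    (by rw [sum_productWeight]; exact Finset.prod_eq_one fun i _ => by simp [hg])
    (fun x hx => by rw [← hrdef, hr.diag_eq_re, hsupp x hx, Complex.ofReal_zero])
  rw [hr.sum_mul_log_productWeight g hsupp] at hk
  have hσ : (ρ * cfc Real.log (sigma U.1 ε)).trace.re =
      ∑ i, ((1 - occupation i r) * Real.log (1 - q) + occupation i r * Real.log q) := by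
    rw [sigma_eq_diagonalIn U hε, cfc_diagonalIn, trace_mul_diagonalIn, Complex.re_sum]
    simp only [Complex.re_mul_ofReal, Function.comp_apply]
    exact hr.sum_mul_log_productWeight _ fun x hx =>
      absurd hx (Finset.prod_pos fun i _ => gibbsWeight_pos hε _).ne'
  rw [relEntropy_sigma U hε, EReal.toReal_coe, mul_sub, Matrix.trace_sub, Complex.sub_re, hσ]
  refine le_trans ?_ (sub_le_sub_right hk _)
  rw [← Finset.sum_sub_distrib]
  refine Finset.sum_le_sum fun i _ => ?_
  refine (binary_relEntropy_ge (hr.occupation_le_one i) hq0 hq1).trans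
    (le_of_eq ?_)
  simp only [hg, Matrix.cons_val_zero, Matrix.cons_val_one]
  ring

end Entropy

/-! ### Transporting a state to the all-zero state -/

section Transport

variable {V : Type*} [Fintype V] [DecidableEq V]

theorem occupation_reset_of_ne {i j : V} (h : i ≠ j) (ρ : Op V) :
    occupation j (reset (annihilation i) ρ) = occupation j ρ := by
  have hc : Commute (annihilation i) (number j) := annihilation_commute_number h
  have hn : (number j).conjTranspose = number j :=
    (Matrix.isHermitian_conjTranspose_mul_self (annihilation j)).eq
  have hc' : Commute (annihilation i).conjTranspose (number j) := by
    have := congrArg Matrix.conjTranspose hc.eq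
    rw [Matrix.conjTranspose_mul, Matrix.conjTranspose_mul, hn] at this
    exact this.symm
  have hP : Commute (annihilation i * (annihilation i).conjTranspose) (number j) :=
    hc.mul_left hc'
  rw [occupation, trace_mul_reset, hP.eq, hc'.eq, mul_assoc, mul_assoc (number j), ← mul_add,
    mul_conjTranspose_projection (annihilation_mul_self i) (annihilation_mul_conjTranspose_add i),
    annihilation_mul_conjTranspose_add, mul_one, occupation]

theorem occupation_reset_self (i : V) (ρ : Op V) :
    occupation i (reset (annihilation i) ρ) = 0 := by
  have h0 := annihilation_mul_self i
  have e1 : annihilation i * (annihilation i).conjTranspose * number i *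
      (annihilation i * (annihilation i).conjTranspose) = 0 := by
    rw [number]
    simp only [mul_assoc]
    rw [← mul_assoc (annihilation i) (annihilation i), h0]
    simp
  have e2 : (annihilation i).conjTranspose * number i * annihilation i = 0 := by
    rw [number]
    simp only [mul_assoc]
    rw [h0]
    simp
  rw [occupation, trace_mul_reset, e1, e2]
  simp

/-- Sites outside `s` keep their occupation, so each new reset is charged at the occupation in the
original `ρ`. -/
theorem exists_state_of_reset {ρ : Op V} (hρ : IsState ρ) {O : Op V} (hO : O.IsHermitian)
    (s : Finset V) : ∃ ρ' : Op V, IsState ρ' ∧ (∀ i ∉ s, occupation i ρ' = occupation i ρ) ∧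
      (∀ i ∈ s, occupation i ρ' = 0) ∧ ‖(O * ρ).trace - (O * ρ').trace‖ ≤
        ∑ i ∈ s, 2 * opNorm (comm O (annihilation i)) * √(occupation i ρ) := by
  induction s using Finset.induction_on with
  | empty => exact ⟨ρ, hρ, fun _ _ => rfl, by simp, by simp⟩
  | insert k s hk ih =>
    obtain ⟨ρ', h1, h2, h3, h4⟩ := ih
    have a0 := annihilation_mul_self k
    have a1 := annihilation_mul_conjTranspose_add k
    refine ⟨reset (annihilation k) ρ', h1.reset a0 a1, fun i hi => ?_, fun i hi => ?_, ?_⟩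
    · rw [Finset.mem_insert, not_or] at hi
      rw [occupation_reset_of_ne (Ne.symm hi.1), h2 i hi.2]
    · by_cases hik : k = i
      · rw [← hik, occupation_reset_self]
      · rw [occupation_reset_of_ne hik, h3 i (Finset.mem_of_mem_insert_of_ne hi (Ne.symm hik))]
    · have h5 := norm_trace_sub_reset_le a0 a1 hO h1
      rw [← number, ← occupation, h2 k hk] at h5
      rw [Finset.sum_insert hk, ← sub_add_sub_cancel _ (O * ρ').trace, add_comm]
      exact (norm_add_le _ _).trans (add_le_add h5 h4)

/-- All diagonal entries but the one at `0` vanish, and a zero diagonal entry of a positive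
semidefinite matrix kills its row and column. -/
theorem eq_ketbra_ketZero {ρ : Op V} (hρ : IsState ρ) (h : ∀ i, occupation i ρ = 0) :
    ρ = ketbra (ketZero V) := by
  have hd (x : Bits V) (hx : x ≠ 0) : ρ x x = 0 := by
    obtain ⟨i, hi⟩ := Function.ne_iff.1 hx
    have h1 := h i
    rw [occupation_eq_sum, Finset.sum_eq_zero_iff_of_nonneg] at h1
    · have := h1 x (Finset.mem_univ x)
      rw [if_pos (Fin.eq_one_of_ne_zero _ hi)] at this
      rw [hρ.diag_eq_re, this, Complex.ofReal_zero]
    · intro y _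
      split_ifs
      exacts [hρ.re_diag_nonneg y, le_rfl]
  have hcol (x : Bits V) (hx : x ≠ 0) (y : Bits V) : ρ y x = 0 := by
    have h1 : star (Pi.single x 1 : Bits V → ℂ) ⬝ᵥ ρ.mulVec (Pi.single x 1) = 0 := by
      simp [hd x hx]
    have h2 := congrFun ((hρ.1.dotProduct_mulVec_zero_iff _).1 h1) y
    simpa using h2
  have h0 : ρ 0 0 = 1 := by
    rw [← hρ.2, Matrix.trace, Finset.sum_eq_single 0]
    · rfl
    · intro x _ hx
      exact hd x hx
    · simp
  ext x y
  rw [ketbra, Matrix.vecMulVec_apply, Pi.star_apply, ketZero]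
  by_cases hy : y = 0
  · by_cases hx : x = 0
    · simp [hx, hy, h0]
    · rw [← hρ.1.1.apply, hcol x hx y]
      simp [hx]
  · rw [hcol y hy x]
    simp [hy]

theorem norm_trace_ketZero_sub_le {ρ : Op V} (hρ : IsState ρ) {O : Op V} (hO : O.IsHermitian) :
    ‖(O * (ketbra (ketZero V) - ρ)).trace‖ ≤
      ∑ i, 2 * opNorm (comm O (annihilation i)) * √(occupation i ρ) := by
  obtain ⟨ρ', h1, -, h3, h4⟩ := exists_state_of_reset hρ hO Finset.univ
  rw [← eq_ketbra_ketZero h1 fun i => h3 i (Finset.mem_univ i), mul_sub, Matrix.trace_sub,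
    norm_sub_rev]
  exact h4

theorem ketbra_mulVec (U : Op V) (ψ : Bits V → ℂ) :
    ketbra (U.mulVec ψ) = U * ketbra ψ * U.conjTranspose := by
  rw [ketbra, ketbra, Matrix.star_mulVec, Matrix.mul_vecMulVec, Matrix.vecMulVec_mul]

theorem opNorm_comm_conj_le (U : Matrix.unitaryGroup (Bits V) ℂ) (O A : Op V) :
    opNorm (comm (U.1.conjTranspose * O * U.1) A) ≤ opNorm (comm O (conj U.1 A)) := by
  have hU : U.1.conjTranspose * U.1 = 1 := U.2.1
  have h : comm (U.1.conjTranspose * O * U.1) A =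
      U.1.conjTranspose * comm O (conj U.1 A) * U.1 := by
    have e1 : U.1.conjTranspose * (O * (U.1 * A * U.1.conjTranspose)) * U.1 =
        U.1.conjTranspose * O * U.1 * A * (U.1.conjTranspose * U.1) := by simp only [mul_assoc]
    have e2 : U.1.conjTranspose * (U.1 * A * U.1.conjTranspose * O) * U.1 =
        U.1.conjTranspose * U.1 * A * (U.1.conjTranspose * O * U.1) := by simp only [mul_assoc]
    rw [comm, comm, conj, mul_sub, sub_mul, e1, e2, hU, mul_one, one_mul]
  rw [h]
  exact opNorm_conj_conjTranspose_le _ _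

theorem opNorm_comm_conjTranspose {O : Op V} (hO : O.IsHermitian) (A : Op V) :
    opNorm (comm O A.conjTranspose) = opNorm (comm O A) := by
  rw [← opNorm_conjTranspose, ← opNorm_neg, comm, comm, Matrix.conjTranspose_sub,
    Matrix.conjTranspose_mul, Matrix.conjTranspose_mul, Matrix.conjTranspose_conjTranspose, hO.eq,
    neg_sub]

theorem lipschitz_eq {U O : Op V} (hO : O.IsHermitian) :
    lipschitz U O = √(∑ i : V, 2 * opNorm (comm O (conj U (annihilation i))) ^ 2) := by
  rw [lipschitz]
  congr 1
  refine Finset.sum_congr rfl fun i _ => ?_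
  have h : conj U (annihilation i).conjTranspose =
      (conj U (annihilation i)).conjTranspose := by
    simp only [conj, Matrix.conjTranspose_mul, Matrix.conjTranspose_conjTranspose, mul_assoc]
  rw [h, opNorm_comm_conjTranspose hO]
  ring

theorem norm_trace_output_sub_le (U : Matrix.unitaryGroup (Bits V) ℂ) {ρ : Op V}
    (hρ : IsState ρ) {O : Op V} (hO : O.IsHermitian) :
    ‖(O * (ketbra (U.1.mulVec (ketZero V)) - ρ)).trace‖ ≤
      lipschitz U.1 O * √(∑ i, 2 * occupation i (U.1.conjTranspose * ρ * U.1)) := by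
  have hU : U.1 * U.1.conjTranspose = 1 := U.2.2
  have hr := hρ.conj U
  have hO' : (U.1.conjTranspose * O * U.1).IsHermitian :=
    Matrix.isHermitian_conjTranspose_mul_mul _ hO
  have htr : (O * (ketbra (U.1.mulVec (ketZero V)) - ρ)).trace =
      (U.1.conjTranspose * O * U.1 *
        (ketbra (ketZero V) - U.1.conjTranspose * ρ * U.1)).trace := by
    have hρ' : ρ = U.1 * (U.1.conjTranspose * ρ * U.1) * U.1.conjTranspose := by
      calc ρ = U.1 * U.1.conjTranspose * ρ * (U.1 * U.1.conjTranspose) := by simp [hU]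
        _ = _ := by simp only [mul_assoc]
    conv_lhs => rw [ketbra_mulVec, hρ', ← sub_mul, ← mul_sub, ← mul_assoc, Matrix.trace_mul_comm]
    simp only [mul_assoc]
  rw [htr]
  refine (norm_trace_ketZero_sub_le hr hO').trans ?_
  set p := fun i => occupation i (U.1.conjTranspose * ρ * U.1)
  set c := fun i => opNorm (comm O (conj U.1 (annihilation i)))
  have h2 : √2 * √2 = 2 := Real.mul_self_sqrt two_pos.le
  -- The factor `2` is split evenly: for Hermitian `O` both commutators at a site have equal norm,
  -- so `∑ (√2 c i)²` is exactly the squared Lipschitz constant.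
  calc _ ≤ ∑ i, (√2 * c i) * √(2 * p i) := by
        refine Finset.sum_le_sum fun i _ => ?_
        rw [Real.sqrt_mul two_pos.le]
        have := mul_le_mul_of_nonneg_right (opNorm_comm_conj_le U O (annihilation i))
          (Real.sqrt_nonneg (p i))
        calc _ ≤ 2 * (c i * √(p i)) := by rw [mul_assoc]; gcongr
          _ = √2 * √2 * (c i * √(p i)) := by rw [h2]
          _ = _ := by ring
    _ ≤ √(∑ i, (√2 * c i) ^ 2) * √(∑ i, √(2 * p i) ^ 2) := Real.sum_mul_le_sqrt_mul_sqrt _ _ _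
    _ = _ := by
        rw [lipschitz_eq hO]
        congr 2
        · refine Finset.sum_congr rfl fun i _ => ?_
          rw [mul_pow, Real.sq_sqrt two_pos.le]
        · refine Finset.sum_congr rfl fun i _ => ?_
          exact Real.sq_sqrt (mul_nonneg two_pos.le (hr.occupation_nonneg i))

end Transport

end QubitCircuit

theorem mainTheorem5 {V : Type*} [Fintype V] [DecidableEq V] (G : SimpleGraph V) (L : ℕ)
    (C : QubitCircuit.Circuit G L) (ε : ℝ) (hε : 0 < ε)
    (ρ : QubitCircuit.Op V) (hρ : QubitCircuit.IsState ρ)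
    (O : QubitCircuit.Op V) (hO : O.IsHermitian) :
    QubitCircuit.relEntropy ρ (QubitCircuit.sigma C.op ε) ≠ ⊤ ∧
      ‖(O * (QubitCircuit.ketbra C.output - ρ)).trace‖ ≤
        QubitCircuit.lipschitz C.op O *
          (√(ε * (Fintype.card V : ℝ)) +
            √(QubitCircuit.relEntropy ρ (QubitCircuit.sigma C.op ε)).toReal) := by
  set U : Matrix.unitaryGroup (QubitCircuit.Bits V) ℂ := ⟨C.op, C.op_mem_unitaryGroup⟩
  have hr := hρ.conj U
  refine ⟨?_, (QubitCircuit.norm_trace_output_sub_le U hρ hO).trans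
    (mul_le_mul_of_nonneg_left ?_ (Real.sqrt_nonneg _))⟩
  · rw [show C.op = U.1 from rfl, QubitCircuit.relEntropy_sigma U hε]
    exact EReal.coe_ne_top _
  · refine (QubitCircuit.sqrt_sum_le Finset.univ hε.le
      (fun i _ => mul_nonneg two_pos.le (hr.occupation_nonneg i)) (fun i _ => by positivity)
      fun i _ => QubitCircuit.sqrt_two_mul_le hε).trans ?_
    exact add_le_add_right
      (Real.sqrt_le_sqrt (QubitCircuit.sum_hellinger_le_relEntropy U hε hρ)) _
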